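/- Let $G(n,r)$ be the random geometric graph on $n$ nodes placed independently and uniformly at random in the unit square $[-1/2,1/2]^2\subset\mathbb R^2$, where two distinct nodes are joined by an edge if and only if their Euclidean distance is less than $r\in[0,\infty)$. A finite simple graph $G$ satisfies Local Pooling (LoP) under the primary interference model if for every nonempty set $L$ of edges of $G$ there are nonnegative weights $(\alpha_e)_{e\in L}$ such that $\sum_{e\in S}\alpha_e=1$ for every maximal schedule $S$ of $L$, that is, for every inclusion-maximal set $S\subseteq L$ of edges no two of which share a node. If $r_n\ge 0$ and $r_n^2\in\omega(n^{-6/5})$ as $n\to\infty$, then $$\lim_{n\to\infty}\mathbb P\big(G(n,r_n)\text{ satisfies LoP}\big)=0 .$$ -/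

import Mathlib

open Filter Topology MeasureTheory Asymptotics
open scoped ENNReal

/-- A schedule of a set `L` of links of `G` under primary interference: a set of links in `L` no two
of which are adjacent in the interference graph of `G`, which is its line graph (two distinct links
interfere iff they share a node). -/
def IsSchedule {V : Type*} (G : SimpleGraph V) (L S : Finset G.edgeSet) : Prop :=
  S ⊆ L ∧ G.lineGraph.IsIndepSet (S : Set G.edgeSet)

/-- A maximal schedule of `L`: no link of `L` can be added to it. -/
def IsMaximalSchedule {V : Type*} (G : SimpleGraph V) (L S : Finset G.edgeSet) : Prop :=
  Maximal (IsSchedule G L) S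

/-- Local pooling for one set `L` of links: there is a nonnegative weighting of the links in `L`
under which all maximal schedules of `L` have total weight `1`
(that is, `αᵀ M = (1, …, 1)`, the columns of `M` being the maximal schedules of `L`). -/
def SubsetLocalPooling {V : Type*} (G : SimpleGraph V) (L : Finset G.edgeSet) : Prop :=
  ∃ α : G.edgeSet → ℝ, (∀ e ∈ L, 0 ≤ α e) ∧
    ∀ S : Finset G.edgeSet, IsMaximalSchedule G L S → ∑ e ∈ S, α e = 1

/-- A finite graph satisfies Local Pooling (LoP), under primary interference, if every nonempty set
of its links satisfies local pooling. -/
def LocalPooling {V : Type*} [Finite V] (G : SimpleGraph V) : Prop :=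
  ∀ L : Finset G.edgeSet, L.Nonempty → SubsetLocalPooling G L

/-- The unit square `[-1/2, 1/2]²` in the Euclidean plane. -/
def unitSquare : Set (EuclideanSpace ℝ (Fin 2)) :=
  {p | ∀ i, p i ∈ Set.Icc (-1 / 2 : ℝ) (1 / 2)}

/-- The uniform distribution on the unit square: Lebesgue measure restricted to it. -/
noncomputable def unitSquareMeasure : Measure (EuclideanSpace ℝ (Fin 2)) :=
  (volume : Measure (EuclideanSpace ℝ (Fin 2))).restrict unitSquare

instance unitSquareMeasure_isProbabilityMeasure : IsProbabilityMeasure unitSquareMeasure := by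
  refine ⟨?_⟩
  have h : unitSquare = (WithLp.ofLp : EuclideanSpace ℝ (Fin 2) → Fin 2 → ℝ) ⁻¹'
      Set.pi Set.univ (fun _ => Set.Icc (-1 / 2 : ℝ) (1 / 2)) := by
    ext p
    simp only [unitSquare, Set.mem_ofPred_eq, Set.mem_preimage, Set.mem_univ_pi]
  rw [unitSquareMeasure, Measure.restrict_apply_univ, h,
    (PiLp.volume_preserving_ofLp (Fin 2)).measure_preimage
      (MeasurableSet.univ_pi fun _ => measurableSet_Icc).nullMeasurableSet, volume_pi_pi]
  norm_num [Real.volume_Icc]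

/-- The geometric graph with node positions `x` and edge distance `r`: distinct nodes are joined
iff their Euclidean distance is less than `r`. -/
def geometricGraph {n : ℕ} (x : Fin n → EuclideanSpace ℝ (Fin 2)) (r : ℝ) :
    SimpleGraph (Fin n) where
  Adj i j := i ≠ j ∧ dist (x i) (x j) < r
  symm := ⟨fun i j h => ⟨h.1.symm, by rw [dist_comm]; exact h.2⟩⟩
  loopless := ⟨fun _ h => h.1 rfl⟩

/-- The probability that the random geometric graph `G(n, r)`, whose `n` nodes are independent and
uniformly distributed in the unit square, has the graph property `P`. -/
noncomputable def rgProb (n : ℕ) (r : ℝ) (P : SimpleGraph (Fin n) → Prop) : ℝ≥0∞ :=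
  (Measure.pi fun _ : Fin n => unitSquareMeasure) {x | P (geometricGraph x r)}

/-! A 6-cycle obstructs local pooling: its six edges split into two perfect matchings of size 3 and
also into three opposite pairs, all maximal schedules, so the total weight would be both 2 and 3.
Since `L` is arbitrary, the cycle need not be induced.

It remains to find six nodes pairwise at distance less than `r`. Cut the square into `K = k ^ 2`
cells of side at most `r / 2`; six nodes in one cell form a clique. About `n ^ 6 / K ^ 5` such
sextuples are expected, which diverges when `k` is `o(n ^ (3/5))`, the scale given by `r ^ 2 ∈ ω(n ^
(-6/5))`.

A second moment argument completes the proof. Nodes are arranged in six disjoint rows of `m = n /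
6`, and only sextuples with one node per row are counted. Rows are independent, so the moments of
this count are sixth powers of one-row moments, and Chebyshev bounds the probability of no sextuple
by `(1 / K) * (1 + K / m) ^ 6` (`measure_forall_cell_exists_row_le`). This vanishes if `K → ∞` and
`K ^ 5 / m ^ 6 → 0`. -/

/-- A graph containing a hexagon (as a not necessarily induced subgraph) fails local pooling. -/
theorem not_localPooling_of_hexagon {V : Type*} [Finite V] (G : SimpleGraph V) (v : Fin 6 → V)
    (hv : Function.Injective v) (hadj : ∀ i, G.Adj (v i) (v (i + 1))) : ¬ LocalPooling G := by
  classical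
  let e : Fin 6 → G.edgeSet := fun i => ⟨s(v i, v (i + 1)), hadj i⟩
  have he : Function.Injective e := by
    intro i j hij
    have h : s(v i, v (i + 1)) = s(v j, v (j + 1)) := congrArg Subtype.val hij
    rw [Sym2.eq_iff, hv.eq_iff, hv.eq_iff, hv.eq_iff, hv.eq_iff] at h
    have key : ∀ i j : Fin 6, i = j ∧ i + 1 = j + 1 ∨ i = j + 1 ∧ i + 1 = j → i = j := by decide
    exact key i j h
  have hline : ∀ i j, G.lineGraph.Adj (e i) (e j) ↔ j = i + 1 ∨ i = j + 1 := by
    intro i j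
    have h : G.lineGraph.Adj (e i) (e j) ↔
        i ≠ j ∧ (i = j ∨ i = j + 1 ∨ i + 1 = j ∨ i + 1 = j + 1) := by
      rw [SimpleGraph.lineGraph_adj_iff_exists, he.ne_iff]
      simp only [e, Sym2.mem_iff]
      constructor
      · rintro ⟨hne, x, rfl | rfl, h | h⟩ <;> simp [hv.eq_iff] at h <;> simp_all
      · rintro ⟨hne, rfl | h | h | h⟩
        · exact absurd rfl hne
        · exact ⟨hne, v i, Or.inl rfl, Or.inr (by rw [h])⟩
        · exact ⟨hne, v (i + 1), Or.inr rfl, Or.inl (by rw [h])⟩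
        · exact ⟨hne, v (i + 1), Or.inr rfl, Or.inr (by rw [h])⟩
    have key : ∀ i j : Fin 6, i ≠ j ∧ (i = j ∨ i = j + 1 ∨ i + 1 = j ∨ i + 1 = j + 1) ↔
        j = i + 1 ∨ i = j + 1 := by decide
    exact h.trans (key i j)
  let L : Finset G.edgeSet := Finset.univ.image e
  -- An independent dominating set of the 6-cycle of edges is a maximal schedule; both conditions on
  -- `T` are decidable in `Fin 6`.
  have hmax : ∀ T : Finset (Fin 6), (∀ i ∈ T, i + 1 ∉ T) →
      (∀ i, i ∈ T ∨ i + 1 ∈ T ∨ ∃ j ∈ T, i = j + 1) →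
      IsMaximalSchedule G L (T.image e) := by
    intro T hT hT'
    refine ⟨⟨Finset.image_subset_image (Finset.subset_univ _), ?_⟩, ?_⟩
    · intro a ha b hb _ hab
      simp only [Finset.coe_image, Set.mem_image, Finset.mem_coe] at ha hb
      obtain ⟨i, hi, rfl⟩ := ha
      obtain ⟨j, hj, rfl⟩ := hb
      rcases (hline i j).1 hab with rfl | rfl
      · exact hT _ hi hj
      · exact hT _ hj hi
    · intro S hS hTS a ha
      obtain ⟨i, -, rfl⟩ := Finset.mem_image.1 (hS.1 ha)
      have key : ∀ j ∈ T, ¬ G.lineGraph.Adj (e i) (e j) := fun j hj hij =>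
        hS.2 ha (hTS (Finset.mem_image_of_mem e hj)) hij.ne hij
      rcases hT' i with h | h | ⟨j, hj, h⟩
      · exact Finset.mem_image_of_mem e h
      · exact absurd ((hline _ _).2 (Or.inl rfl)) (key _ h)
      · exact absurd ((hline _ _).2 (Or.inr h)) (key _ hj)
  intro hLP
  obtain ⟨α, -, hα⟩ := hLP L ⟨e 0, Finset.mem_image_of_mem e (Finset.mem_univ _)⟩
  have hsum : ∀ T : Finset (Fin 6), (∀ i ∈ T, i + 1 ∉ T) →
      (∀ i, i ∈ T ∨ i + 1 ∈ T ∨ ∃ j ∈ T, i = j + 1) → ∑ i ∈ T, α (e i) = 1 := by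
    intro T h₁ h₂
    rw [← hα _ (hmax T h₁ h₂), Finset.sum_image fun _ _ _ _ h => he h]
  -- `h1 + h2` gives total weight 2, while `h3 + h4 + h5` gives 3.
  have h1 := hsum {0, 2, 4} (by decide) (by decide)
  have h2 := hsum {1, 3, 5} (by decide) (by decide)
  have h3 := hsum {0, 3} (by decide) (by decide)
  have h4 := hsum {1, 4} (by decide) (by decide)
  have h5 := hsum {2, 5} (by decide) (by decide)
  simp at h1 h2 h3 h4 h5
  linarith

/-- Reading off an injective `ι × κ`-array of coordinates preserves the product of copies of `μ`. -/
theorem measurePreserving_pi_array {Ω ι κ J : Type*} [MeasurableSpace Ω] [Fintype ι] [Fintype κ]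
    [Fintype J] (μ : Measure Ω) [IsProbabilityMeasure μ] (e : ι × κ ↪ J) :
    MeasurePreserving (fun (x : J → Ω) i a => x (e (i, a))) (Measure.pi fun _ => μ)
      (Measure.pi fun _ => Measure.pi fun _ => μ) := by
  have h1 : MeasurePreserving (fun (x : J → Ω) p => x (e p)) (Measure.pi fun _ => μ)
      (Measure.pi fun _ : ι × κ => μ) := by
    refine ⟨by fun_prop, ?_⟩
    have h := (ProbabilityTheory.iIndepFun_pi (μ := fun _ : J => μ) (X := fun _ => id)
      (fun _ => aemeasurable_id)).precomp e.injective
    rw [h.map_fun_eq_pi_map fun p => (measurable_pi_apply (e p)).aemeasurable]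
    congr 1
    funext p
    exact (measurePreserving_eval (fun _ : J => μ) (e p)).map_eq
  have h2 : MeasurePreserving (MeasurableEquiv.curry ι κ Ω) (Measure.pi fun _ => μ)
      (Measure.pi fun _ => Measure.pi fun _ => μ) := by
    refine ⟨MeasurableEquiv.measurable _, ?_⟩
    simp only [← Measure.infinitePi_eq_pi]
    exact Measure.infinitePi_map_curry (fun _ _ => μ)
  exact h2.comp h1

/-! ### Moments of occupancy numbers and the birthday problem -/

section Occupancy

variable {Ω C κ : Type*} [Fintype κ]

/-- The number of the points `x a` that lie in the set `A`. -/
noncomputable def occupancy (A : Set Ω) (x : κ → Ω) : ℝ :=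
  ∑ a, A.indicator (fun _ => (1 : ℝ)) (x a)

theorem occupancy_nonneg (A : Set Ω) (x : κ → Ω) : 0 ≤ occupancy A x :=
  Finset.sum_nonneg fun _ _ => Set.indicator_nonneg (fun _ _ => zero_le_one) _

theorem occupancy_le (A : Set Ω) (x : κ → Ω) : occupancy A x ≤ Fintype.card κ := by
  refine (Finset.sum_le_sum fun a _ => Set.indicator_le_self' (s := A) (f := fun _ => (1 : ℝ))
    (fun _ _ => zero_le_one) (x a)).trans (by simp)

theorem exists_mem_of_occupancy_ne_zero {A : Set Ω} {x : κ → Ω} (h : occupancy A x ≠ 0) :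
    ∃ a, x a ∈ A := by
  obtain ⟨a, -, ha⟩ := Finset.exists_ne_zero_of_sum_ne_zero h
  exact ⟨a, Set.mem_of_indicator_ne_zero ha⟩

/-- The number of ways to choose, for some cell, one point of that cell in each row. -/
noncomputable def rowChoices {ι : Type*} [Fintype ι] [Fintype C] (A : C → Set Ω)
    (x : ι → κ → Ω) : ℝ :=
  ∑ c, ∏ i, occupancy (A c) (x i)

theorem rowChoices_nonneg {ι : Type*} [Fintype ι] [Fintype C] (A : C → Set Ω)
    (x : ι → κ → Ω) : 0 ≤ rowChoices A x :=
  Finset.sum_nonneg fun _ _ => Finset.prod_nonneg fun _ _ => occupancy_nonneg _ _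

theorem prod_occupancy_le {ι : Type*} [Fintype ι] (A : C → Set Ω) (c : C) (x : ι → κ → Ω) :
    ∏ i, occupancy (A c) (x i) ≤ (Fintype.card κ : ℝ) ^ Fintype.card ι :=
  (Finset.prod_le_prod (fun _ _ => occupancy_nonneg _ _) fun i _ => occupancy_le _ _).trans
    (by simp)

variable [MeasurableSpace Ω]

theorem measurable_occupancy {A : Set Ω} (hA : MeasurableSet A) :
    Measurable (occupancy A : (κ → Ω) → ℝ) :=
  Finset.measurable_sum _ fun a _ =>
    (measurable_const.indicator hA).comp (measurable_pi_apply a)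

variable (μ : Measure Ω) [IsProbabilityMeasure μ]

theorem integrable_of_measurable_of_bounded {X : Type*} [MeasurableSpace X] {ν : Measure X}
    [IsFiniteMeasure ν] {f : X → ℝ} (hf : Measurable f) (B : ℝ) (h0 : ∀ x, 0 ≤ f x)
    (hB : ∀ x, f x ≤ B) : Integrable f ν :=
  Integrable.of_bound hf.aestronglyMeasurable B
    (Eventually.of_forall fun x => by rw [Real.norm_of_nonneg (h0 x)]; exact hB x)

theorem integral_indicator_eval {A : Set Ω} (hA : MeasurableSet A) (a : κ) :
    ∫ x, A.indicator (fun _ => (1 : ℝ)) (x a) ∂(Measure.pi fun _ : κ => μ) = μ.real A := by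
  have h := (measurePreserving_eval (fun _ : κ => μ) a).map_eq
  rw [← integral_map (φ := Function.eval a) (μ := Measure.pi fun _ : κ => μ)
    (f := A.indicator fun _ => (1 : ℝ)) (measurable_pi_apply a).aemeasurable
    (measurable_const.indicator hA).aestronglyMeasurable, h]
  simp [integral_indicator hA]

theorem integral_occupancy {A : Set Ω} (hA : MeasurableSet A) :
    ∫ x, occupancy A x ∂(Measure.pi fun _ : κ => μ) = Fintype.card κ * μ.real A := by
  unfold occupancy
  rw [integral_finsetSum]
  · simp [integral_indicator_eval μ hA]
  · intro a _
    exact integrable_of_measurable_of_bounded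
      ((measurable_const.indicator hA).comp (measurable_pi_apply a)) 1
      (fun x => Set.indicator_nonneg (fun _ _ => zero_le_one) _)
      (fun x => Set.indicator_le_self' (fun _ _ => zero_le_one) _)

theorem integral_indicator_eval_mul_eval {A B : Set Ω} (hA : MeasurableSet A) (hB : MeasurableSet B)
    {a b : κ} (hab : a ≠ b) :
    ∫ x, A.indicator (fun _ => (1 : ℝ)) (x a) * B.indicator (fun _ => (1 : ℝ)) (x b)
      ∂(Measure.pi fun _ : κ => μ) = μ.real A * μ.real B := by
  have h := (ProbabilityTheory.iIndepFun_pi (μ := fun _ : κ => μ) (X := fun _ => id)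
      (fun _ => aemeasurable_id)).indepFun hab
  have h' := (h.comp (_mγ := inferInstance) (_mγ' := inferInstance)
    (φ := A.indicator fun _ => (1 : ℝ)) (ψ := B.indicator fun _ => (1 : ℝ))
    (measurable_const.indicator hA) (measurable_const.indicator hB))
  rw [← integral_indicator_eval μ hA a, ← integral_indicator_eval μ hB b]
  exact h'.integral_fun_mul_eq_mul_integral
    ((measurable_const.indicator hA).comp (measurable_pi_apply a)).aestronglyMeasurable
    ((measurable_const.indicator hB).comp (measurable_pi_apply b)).aestronglyMeasurable

/-- Second mixed moments of occupancy numbers: the diagonal contributes `card κ * μ (A ∩ B)`. -/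
theorem integral_occupancy_mul_le {A B : Set Ω} (hA : MeasurableSet A) (hB : MeasurableSet B) :
    ∫ x, occupancy A x * occupancy B x ∂(Measure.pi fun _ : κ => μ) ≤
      (Fintype.card κ * μ.real A) * (Fintype.card κ * μ.real B)
        + Fintype.card κ * μ.real (A ∩ B) := by
  classical
  have hint : ∀ a b : κ, Integrable (fun x : κ → Ω => A.indicator (fun _ => (1 : ℝ)) (x a) *
      B.indicator (fun _ => (1 : ℝ)) (x b)) (Measure.pi fun _ : κ => μ) := by
    intro a b
    refine integrable_of_measurable_of_bounded
      (((measurable_const.indicator hA).comp (measurable_pi_apply a)).mul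
        ((measurable_const.indicator hB).comp (measurable_pi_apply b))) 1 (fun x => ?_) (fun x => ?_)
    · exact mul_nonneg (Set.indicator_nonneg (fun _ _ => zero_le_one) _)
        (Set.indicator_nonneg (fun _ _ => zero_le_one) _)
    · exact mul_le_one₀ (Set.indicator_le_self' (fun _ _ => zero_le_one) _)
        (Set.indicator_nonneg (fun _ _ => zero_le_one) _)
        (Set.indicator_le_self' (fun _ _ => zero_le_one) _)
  unfold occupancy
  simp only [Finset.sum_mul_sum]
  rw [integral_finsetSum _ fun a _ => integrable_finsetSum _ fun b _ => hint a b]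
  simp only [integral_finsetSum _ fun b _ => hint _ b]
  have hle : ∀ a b : κ, ∫ x, A.indicator (fun _ => (1 : ℝ)) (x a) *
      B.indicator (fun _ => (1 : ℝ)) (x b) ∂(Measure.pi fun _ : κ => μ) ≤
      μ.real A * μ.real B + if a = b then μ.real (A ∩ B) else 0 := by
    intro a b
    split_ifs with hab
    · subst hab
      have : (fun x : κ → Ω => A.indicator (fun _ => (1 : ℝ)) (x a) *
          B.indicator (fun _ => (1 : ℝ)) (x a)) =
          fun x => (A ∩ B).indicator (fun _ => (1 : ℝ)) (x a) := by
        funext x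
        rw [← Set.inter_indicator_mul]
        simp
      rw [this, integral_indicator_eval μ (hA.inter hB)]
      exact le_add_of_nonneg_left (by positivity)
    · rw [integral_indicator_eval_mul_eval μ hA hB hab, add_zero]
  refine (Finset.sum_le_sum fun a _ => Finset.sum_le_sum fun b _ => hle a b).trans (le_of_eq ?_)
  simp [Finset.sum_add_distrib]
  ring

variable {ι : Type*} [Fintype ι] {A : C → Set Ω}

theorem integrable_prod_occupancy (hA : ∀ c, MeasurableSet (A c)) (c : C) :
    Integrable (fun x : ι → κ → Ω => ∏ i, occupancy (A c) (x i))
      (Measure.pi fun _ => Measure.pi fun _ => μ) :=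
  integrable_of_measurable_of_bounded
    (Finset.measurable_prod _ fun i _ => (measurable_occupancy (hA c)).comp (measurable_pi_apply i))
    _ (fun _ => Finset.prod_nonneg fun _ _ => occupancy_nonneg _ _) (prod_occupancy_le A c)

variable [Fintype C]

theorem measurable_rowChoices (hA : ∀ c, MeasurableSet (A c)) :
    Measurable (rowChoices A : (ι → κ → Ω) → ℝ) :=
  Finset.measurable_sum _ fun c _ => Finset.measurable_prod _ fun i _ =>
    (measurable_occupancy (hA c)).comp (measurable_pi_apply i)

theorem memLp_rowChoices (hA : ∀ c, MeasurableSet (A c)) :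
    MemLp (rowChoices A : (ι → κ → Ω) → ℝ) 2 (Measure.pi fun _ => Measure.pi fun _ => μ) := by
  refine MemLp.of_bound (measurable_rowChoices hA).aestronglyMeasurable
    (∑ _c : C, (Fintype.card κ : ℝ) ^ Fintype.card ι) (Eventually.of_forall fun x => ?_)
  rw [Real.norm_of_nonneg (rowChoices_nonneg A x)]
  exact Finset.sum_le_sum fun c _ => prod_occupancy_le A c x

theorem integral_rowChoices (hA : ∀ c, MeasurableSet (A c)) {p : ℝ} (hp : ∀ c, μ.real (A c) = p) :
    ∫ x, rowChoices A x ∂(Measure.pi fun _ : ι => Measure.pi fun _ : κ => μ) =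
      Fintype.card C * (Fintype.card κ * p) ^ Fintype.card ι := by
  unfold rowChoices
  rw [integral_finsetSum _ fun c _ => integrable_prod_occupancy μ hA c]
  simp [integral_fintype_prod_eq_pow, integral_occupancy μ (hA _), hp]

/-- Expand the square over pairs of cells; each term factors over the independent rows. Distinct
cells are disjoint, so no point is counted twice and the term is at most the product of the means.
Only the `card C` diagonal pairs contribute an excess. -/
theorem integral_rowChoices_sq_le (hA : ∀ c, MeasurableSet (A c)) {p : ℝ}
    (hp : ∀ c, μ.real (A c) = p) (hdisj : Pairwise fun c d => Disjoint (A c) (A d)) :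
    ∫ x, rowChoices A x ^ 2 ∂(Measure.pi fun _ : ι => Measure.pi fun _ : κ => μ) ≤
      (Fintype.card C * (Fintype.card κ * p) ^ Fintype.card ι) ^ 2 +
        Fintype.card C * ((Fintype.card κ * p) ^ 2 + Fintype.card κ * p) ^ Fintype.card ι := by
  classical
  have hsq : ∀ x : ι → κ → Ω, rowChoices A x ^ 2 =
      ∑ c, ∑ d, ∏ i, (occupancy (A c) (x i) * occupancy (A d) (x i)) := by
    intro x
    simp only [rowChoices, sq, Finset.sum_mul_sum, Finset.prod_mul_distrib]
  have hint : ∀ c d, Integrable (fun x : ι → κ → Ω =>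
      ∏ i, (occupancy (A c) (x i) * occupancy (A d) (x i)))
      (Measure.pi fun _ => Measure.pi fun _ => μ) := by
    intro c d
    simp only [Finset.prod_mul_distrib]
    refine integrable_of_measurable_of_bounded (Measurable.mul
      (Finset.measurable_prod _ fun i _ =>
        (measurable_occupancy (hA c)).comp (measurable_pi_apply i))
      (Finset.measurable_prod _ fun i _ =>
        (measurable_occupancy (hA d)).comp (measurable_pi_apply i)))
      ((Fintype.card κ : ℝ) ^ Fintype.card ι * (Fintype.card κ : ℝ) ^ Fintype.card ι)
      (fun x => ?_) (fun x => ?_)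
    · exact mul_nonneg (Finset.prod_nonneg fun _ _ => occupancy_nonneg _ _)
        (Finset.prod_nonneg fun _ _ => occupancy_nonneg _ _)
    · exact mul_le_mul (prod_occupancy_le A c x) (prod_occupancy_le A d x)
        (Finset.prod_nonneg fun _ _ => occupancy_nonneg _ _) (by positivity)
  have hterm : ∀ c d, ∫ x : ι → κ → Ω, ∏ i, (occupancy (A c) (x i) * occupancy (A d) (x i))
      ∂(Measure.pi fun _ => Measure.pi fun _ => μ) ≤
      ((Fintype.card κ * p) ^ 2) ^ Fintype.card ι + if c = d then
        ((Fintype.card κ * p) ^ 2 + Fintype.card κ * p) ^ Fintype.card ι else 0 := by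
    intro c d
    have hp0 : 0 ≤ p := hp c ▸ measureReal_nonneg
    rw [integral_fintype_prod_eq_pow fun y : κ → Ω => occupancy (A c) y * occupancy (A d) y]
    have h0 : 0 ≤ ∫ y : κ → Ω, occupancy (A c) y * occupancy (A d) y ∂(Measure.pi fun _ => μ) :=
      integral_nonneg fun y => mul_nonneg (occupancy_nonneg _ _) (occupancy_nonneg _ _)
    have h1 := integral_occupancy_mul_le (κ := κ) μ (hA c) (hA d)
    rw [hp, hp] at h1
    split_ifs with hcd
    · subst hcd
      rw [Set.inter_self, hp, ← sq] at h1
      -- The off-diagonal bound is added here too, so that summing it over all pairs gives exactly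
      -- the squared mean.
      exact (pow_le_pow_left₀ h0 h1 _).trans (le_add_of_nonneg_left (by positivity))
    · rw [(hdisj hcd).inter_eq, measureReal_empty, mul_zero, add_zero, ← sq] at h1
      rw [add_zero]
      exact pow_le_pow_left₀ h0 h1 _
  simp only [hsq]
  rw [integral_finsetSum _ fun c _ => integrable_finsetSum _ fun d _ => hint c d]
  simp only [integral_finsetSum _ fun d _ => hint _ d]
  refine (Finset.sum_le_sum fun c _ => Finset.sum_le_sum fun d _ => hterm c d).trans (le_of_eq ?_)
  simp [Finset.sum_add_distrib]
  ring

/-- Second moment bound for the generalized birthday problem: throw the points of an `ι × κ`-array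
into equiprobable cells. It is unlikely that no cell meets every row. -/
theorem measure_forall_cell_exists_row_le [Nonempty C] [Nonempty κ]
    (hA : ∀ c, MeasurableSet (A c)) (hp : ∀ c, μ.real (A c) = 1 / Fintype.card C)
    (hdisj : Pairwise fun c d => Disjoint (A c) (A d)) :
    (Measure.pi fun _ : ι => Measure.pi fun _ : κ => μ) {x | ∀ c, ∃ i, ∀ a, x i a ∉ A c} ≤
      ENNReal.ofReal (1 / Fintype.card C *
        (1 + Fintype.card C / Fintype.card κ) ^ Fintype.card ι) := by
  set P := Measure.pi fun _ : ι => Measure.pi fun _ : κ => μ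
  have hK : (0 : ℝ) < Fintype.card C := by exact_mod_cast Fintype.card_pos
  have hm : (0 : ℝ) < Fintype.card κ := by exact_mod_cast Fintype.card_pos
  have hmean := integral_rowChoices (ι := ι) (κ := κ) μ hA hp
  have hsecond := integral_rowChoices_sq_le (ι := ι) (κ := κ) μ hA hp hdisj
  set M : ℝ := Fintype.card C * (Fintype.card κ * (1 / Fintype.card C)) ^ Fintype.card ι
  have hM : 0 < M := by positivity
  -- On this event the count is 0, so it deviates from its mean by the full mean `M`.
  have hsub : {x : ι → κ → Ω | ∀ c, ∃ i, ∀ a, x i a ∉ A c} ⊆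
      {x | M ≤ |rowChoices A x - ∫ y, rowChoices A y ∂P|} := by
    intro x hx
    have h0 : rowChoices A x = 0 := by
      refine Finset.sum_eq_zero fun c _ => ?_
      obtain ⟨i, hi⟩ := hx c
      refine Finset.prod_eq_zero (Finset.mem_univ i) ?_
      by_contra h
      obtain ⟨a, ha⟩ := exists_mem_of_occupancy_ne_zero h
      exact hi a ha
    change M ≤ |rowChoices A x - ∫ y, rowChoices A y ∂P|
    rw [h0, hmean, zero_sub, abs_neg]
    exact le_abs_self M
  refine (measure_mono hsub).trans
    ((ProbabilityTheory.meas_ge_le_variance_div_sq (memLp_rowChoices μ hA) hM).trans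
      (ENNReal.ofReal_le_ofReal ?_))
  rw [ProbabilityTheory.variance_eq_sub (memLp_rowChoices μ hA), hmean, div_le_iff₀ (by positivity)]
  simp only [Pi.pow_apply]
  rw [sub_le_iff_le_add']
  refine hsecond.trans (add_le_add_right (le_of_eq ?_) _)
  simp only [M]
  have h : ((Fintype.card κ : ℝ) * (1 / Fintype.card C)) ^ 2 +
      Fintype.card κ * (1 / Fintype.card C) = (1 + Fintype.card C / Fintype.card κ) *
        (Fintype.card κ * (1 / Fintype.card C)) ^ 2 := by
    field_simp
  rw [h, mul_pow _ _ (Fintype.card ι), pow_right_comm _ 2]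
  field_simp

end Occupancy

/-! ### Grid cells and cliques in the geometric graph -/

/-- The cells of the subdivision of the unit square into `k ^ 2` congruent squares. -/
def gridCell (k : ℕ) (c : Fin 2 → Fin k) : Set (EuclideanSpace ℝ (Fin 2)) :=
  {p | ∀ i, p i ∈ Set.Ico (-1 / 2 + (c i : ℝ) / k) (-1 / 2 + ((c i : ℝ) + 1) / k)}

theorem gridCell_eq_preimage (k : ℕ) (c : Fin 2 → Fin k) :
    gridCell k c = (WithLp.ofLp : EuclideanSpace ℝ (Fin 2) → Fin 2 → ℝ) ⁻¹'
      Set.pi Set.univ fun i => Set.Ico (-1 / 2 + (c i : ℝ) / k) (-1 / 2 + ((c i : ℝ) + 1) / k) := by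
  ext p
  simp only [gridCell, Set.mem_ofPred_eq, Set.mem_preimage, Set.mem_univ_pi]

theorem measurableSet_gridCell (k : ℕ) (c : Fin 2 → Fin k) : MeasurableSet (gridCell k c) := by
  rw [gridCell_eq_preimage]
  exact (PiLp.volume_preserving_ofLp (Fin 2)).measurable
    (MeasurableSet.univ_pi fun _ => measurableSet_Ico)

theorem gridCell_subset_unitSquare (k : ℕ) (c : Fin 2 → Fin k) : gridCell k c ⊆ unitSquare := by
  intro p hp i
  have hk : (0 : ℝ) < k := by exact_mod_cast (c i).pos
  have h1 : (0 : ℝ) ≤ (c i : ℝ) / k := by positivity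
  have h2 : ((c i : ℝ) + 1) / k ≤ 1 := by
    rw [div_le_one hk]
    exact_mod_cast (c i).isLt
  obtain ⟨h3, h4⟩ := hp i
  constructor <;> linarith

theorem unitSquareMeasure_gridCell (k : ℕ) (c : Fin 2 → Fin k) :
    unitSquareMeasure.real (gridCell k c) = 1 / Fintype.card (Fin 2 → Fin k) := by
  have hk : (0 : ℝ) < k := by exact_mod_cast (c 0).pos
  rw [measureReal_def, unitSquareMeasure, Measure.restrict_apply (measurableSet_gridCell k c),
    Set.inter_eq_left.2 (gridCell_subset_unitSquare k c), gridCell_eq_preimage,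
    (PiLp.volume_preserving_ofLp (Fin 2)).measure_preimage
      (MeasurableSet.univ_pi fun _ => measurableSet_Ico).nullMeasurableSet, volume_pi_pi]
  have h : ∀ i, -1 / 2 + ((c i : ℝ) + 1) / k - (-1 / 2 + (c i : ℝ) / k) = 1 / k := fun i => by ring
  simp only [Real.volume_Ico, h]
  simp [ENNReal.toReal_ofReal]

/-- Half-open cells are exactly disjoint. They miss part of the boundary of the square, which is
harmless: no covering is needed. -/
theorem pairwise_disjoint_gridCell (k : ℕ) :
    Pairwise fun c d => Disjoint (gridCell k c) (gridCell k d) := by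
  intro c d hcd
  rw [Set.disjoint_left]
  intro p hc hd
  refine hcd (funext fun i => Fin.ext ?_)
  have hk : (0 : ℝ) < k := by exact_mod_cast (c i).pos
  obtain ⟨h1, h2⟩ := hc i
  obtain ⟨h3, h4⟩ := hd i
  have h5 : (c i : ℝ) < (d i : ℝ) + 1 := (div_lt_div_iff_of_pos_right hk).1 (by linarith)
  have h6 : (d i : ℝ) < (c i : ℝ) + 1 := (div_lt_div_iff_of_pos_right hk).1 (by linarith)
  norm_cast at h5 h6
  omega

theorem dist_lt_of_mem_gridCell {k : ℕ} {c : Fin 2 → Fin k} {r : ℝ} (hkr : 2 ≤ k * r)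
    {p q : EuclideanSpace ℝ (Fin 2)} (hp : p ∈ gridCell k c) (hq : q ∈ gridCell k c) :
    dist p q < r := by
  have hk : (0 : ℝ) < k := by exact_mod_cast (c 0).pos
  have hr : 1 / (k : ℝ) ≤ r / 2 := by
    rw [div_le_div_iff₀ hk two_pos]
    linarith
  have hr0 : 0 < r := by
    have : (0 : ℝ) < 1 / k := by positivity
    linarith
  -- Each coordinate differs by less than `r / 2`, so the squared distance is below `r ^ 2 / 2`.
  have hcoord : ∀ i, dist (p i) (q i) ^ 2 < (r / 2) ^ 2 := by
    intro i
    refine pow_lt_pow_left₀ (lt_of_lt_of_le ?_ hr) dist_nonneg two_ne_zero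
    obtain ⟨h1, h2⟩ := hp i
    obtain ⟨h3, h4⟩ := hq i
    rw [add_div] at h2 h4
    rw [Real.dist_eq, abs_lt]
    constructor <;> linarith
  rw [EuclideanSpace.dist_eq, Real.sqrt_lt' hr0, Fin.sum_univ_two]
  have h0 := hcoord 0
  have h1 := hcoord 1
  nlinarith

/-- If six points from distinct rows of an array of nodes share a small cell, then local pooling
fails. -/
theorem not_localPooling_of_common_cell {n m k : ℕ} {r : ℝ} (hkr : 2 ≤ k * r)
    (e : Fin 6 × Fin m ↪ Fin n) {x : Fin n → EuclideanSpace ℝ (Fin 2)} {c : Fin 2 → Fin k}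
    (h : ∀ i, ∃ a, x (e (i, a)) ∈ gridCell k c) : ¬ LocalPooling (geometricGraph x r) := by
  choose a ha using h
  have hinj : Function.Injective fun i => e (i, a i) := fun i j hij =>
    congrArg Prod.fst (e.injective hij)
  refine not_localPooling_of_hexagon _ (fun i => e (i, a i)) hinj fun i =>
    ⟨hinj.ne ?_, dist_lt_of_mem_gridCell hkr (ha _) (ha _)⟩
  revert i
  decide

theorem rgProb_localPooling_le {n m k : ℕ} {r : ℝ} (hkr : 2 ≤ k * r) (hk : 0 < k) (hm : 0 < m)
    (hmn : 6 * m ≤ n) :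
    rgProb n r (fun G => LocalPooling G) ≤
      ENNReal.ofReal (1 / (k : ℝ) ^ 2 * (1 + (k : ℝ) ^ 2 / m) ^ 6) := by
  let e : Fin 6 × Fin m ↪ Fin n :=
    finProdFinEquiv.toEmbedding.trans (Fin.castLEEmb hmn)
  have : Nonempty (Fin k) := ⟨⟨0, hk⟩⟩
  have : Nonempty (Fin m) := ⟨⟨0, hm⟩⟩
  have hpres := measurePreserving_pi_array unitSquareMeasure e
  have hbound := measure_forall_cell_exists_row_le (ι := Fin 6) (κ := Fin m) unitSquareMeasure
    (measurableSet_gridCell k) (unitSquareMeasure_gridCell k) (pairwise_disjoint_gridCell k)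
  have hmeas : MeasurableSet {x : Fin 6 → Fin m → EuclideanSpace ℝ (Fin 2) |
      ∀ c, ∃ i, ∀ a, x i a ∉ gridCell k c} := by
    have h : ∀ c i a, MeasurableSet {x : Fin 6 → Fin m → EuclideanSpace ℝ (Fin 2) |
        x i a ∉ gridCell k c} := fun c i a =>
      (show Measurable fun x : Fin 6 → Fin m → EuclideanSpace ℝ (Fin 2) => x i a by fun_prop)
        (measurableSet_gridCell k c).compl
    simp only [Set.ofPred_forall, Set.ofPred_exists]
    exact MeasurableSet.iInter fun c => MeasurableSet.iUnion fun i => MeasurableSet.iInter fun a =>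
      h c i a
  rw [← hpres.measure_preimage hmeas.nullMeasurableSet] at hbound
  -- Only monotonicity is used, so measurability of the local pooling event is not needed.
  refine (measure_mono ?_).trans (hbound.trans (le_of_eq (by simp)))
  intro x hx c
  by_contra! h
  exact not_localPooling_of_common_cell hkr e h hx

/-! ### Asymptotics of the grid size and of the bound -/

theorem tendsto_inv_mul_rpow {r : ℕ → ℝ} (hr : ∀ n, 0 ≤ r n)
    (hω : (fun n : ℕ => 1 / (n : ℝ) ^ (6 / 5 : ℝ)) =o[atTop] fun n : ℕ => r n ^ 2) :
    Tendsto (fun n : ℕ => 1 / (r n * (n : ℝ) ^ (3 / 5 : ℝ))) atTop (𝓝 0) := by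
  have h := (Real.continuous_sqrt.tendsto 0).comp hω.tendsto_div_nhds_zero
  rw [Real.sqrt_zero] at h
  refine h.congr fun n => ?_
  have hn : (n : ℝ) ^ (6 / 5 : ℝ) = ((n : ℝ) ^ (3 / 5 : ℝ)) ^ 2 := by
    rw [← Real.rpow_natCast, ← Real.rpow_mul n.cast_nonneg]
    norm_num
  have hnn : 0 ≤ (n : ℝ) ^ (3 / 5 : ℝ) := by positivity
  simp only [Function.comp_apply]
  rw [hn, div_div, ← mul_pow, Real.sqrt_div zero_le_one, Real.sqrt_one, mul_comm,
    Real.sqrt_sq (mul_nonneg (hr n) hnn)]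

theorem eventually_pos_of_isLittleO {r : ℕ → ℝ} (hr : ∀ n, 0 ≤ r n)
    (hω : (fun n : ℕ => 1 / (n : ℝ) ^ (6 / 5 : ℝ)) =o[atTop] fun n : ℕ => r n ^ 2) :
    ∀ᶠ n in atTop, 0 < r n := by
  filter_upwards [hω.bound one_pos, eventually_gt_atTop 0] with n h hn
  refine lt_of_le_of_ne (hr n) fun h0 => ?_
  have hn' : (0 : ℝ) < n := by exact_mod_cast hn
  have hpos : (0 : ℝ) < 1 / (n : ℝ) ^ (6 / 5 : ℝ) := by positivity
  rw [← h0, Real.norm_of_nonneg hpos.le] at h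
  simp at h
  simp at hpos
  linarith

/-- A grid size that is fine enough for the radius `r`, grows at least like `n ^ (1 / 10)`, and
has few cells. -/
noncomputable def gridSize (r : ℝ) (n : ℕ) : ℕ := ⌈2 / r⌉₊ + ⌈(n : ℝ) ^ (1 / 10 : ℝ)⌉₊

theorem tendsto_gridSize_atTop (r : ℕ → ℝ) :
    Tendsto (fun n => (gridSize (r n) n : ℝ)) atTop atTop := by
  refine tendsto_atTop_mono (fun n => ?_)
    ((tendsto_rpow_atTop (y := 1 / 10) (by norm_num)).comp tendsto_natCast_atTop_atTop)
  simp only [Function.comp_apply, gridSize]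
  push_cast
  have h1 := Nat.le_ceil ((n : ℝ) ^ (1 / 10 : ℝ))
  have h2 : (0 : ℝ) ≤ ⌈2 / r n⌉₊ := by positivity
  linarith

theorem tendsto_gridSize_div_rpow {r : ℕ → ℝ} (hr : ∀ n, 0 ≤ r n)
    (hω : (fun n : ℕ => 1 / (n : ℝ) ^ (6 / 5 : ℝ)) =o[atTop] fun n : ℕ => r n ^ 2) :
    Tendsto (fun n : ℕ => (gridSize (r n) n : ℝ) / (n : ℝ) ^ (3 / 5 : ℝ)) atTop (𝓝 0) := by
  have h1 := (tendsto_inv_mul_rpow hr hω).const_mul 2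
  have h2 : Tendsto (fun n : ℕ => (n : ℝ) ^ (-(1 / 2) : ℝ)) atTop (𝓝 0) :=
    (tendsto_rpow_neg_atTop (by norm_num)).comp tendsto_natCast_atTop_atTop
  have h3 : Tendsto (fun n : ℕ => (n : ℝ) ^ (-(3 / 5) : ℝ)) atTop (𝓝 0) :=
    (tendsto_rpow_neg_atTop (by norm_num)).comp tendsto_natCast_atTop_atTop
  -- The terms come from `2 / r n`, from `n ^ (1/10)`, and from rounding up twice, each divided by
  -- `n ^ (3/5)`. The summand `n ^ (1/10)` keeps the grid growing even if `r n` does not tend to 0.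
  have h := (h1.add h2).add (h3.const_mul 2)
  norm_num only [mul_zero, add_zero] at h
  refine squeeze_zero' (Eventually.of_forall fun n => by positivity) ?_ h
  filter_upwards [eventually_gt_atTop 0] with n hn
  have hn' : (0 : ℝ) < n := by exact_mod_cast hn
  have hq : (0 : ℝ) < (n : ℝ) ^ (3 / 5 : ℝ) := by positivity
  have e2 : (n : ℝ) ^ (-(1 / 2) : ℝ) * (n : ℝ) ^ (3 / 5 : ℝ) = (n : ℝ) ^ (1 / 10 : ℝ) := by
    rw [← Real.rpow_add hn']
    norm_num
  have e3 : (n : ℝ) ^ (-(3 / 5) : ℝ) * (n : ℝ) ^ (3 / 5 : ℝ) = 1 := by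
    rw [← Real.rpow_add hn']
    norm_num
  have e1 : 2 * (1 / (r n * (n : ℝ) ^ (3 / 5 : ℝ))) * (n : ℝ) ^ (3 / 5 : ℝ) = 2 / r n := by
    rw [one_div, mul_inv, mul_assoc, mul_assoc, inv_mul_cancel₀ hq.ne', mul_one, div_eq_mul_inv]
  rw [div_le_iff₀ hq, add_mul, add_mul, e1, e2, mul_assoc, e3]
  have c1 := (Nat.ceil_lt_add_one (a := 2 / r n) (div_nonneg zero_le_two (hr n))).le
  have c2 := (Nat.ceil_lt_add_one (a := (n : ℝ) ^ (1 / 10 : ℝ)) (by positivity)).le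
  simp only [gridSize]
  push_cast
  linarith

theorem tendsto_occupancy_bound {k : ℕ → ℕ} (hk : Tendsto (fun n => (k n : ℝ)) atTop atTop)
    (hk' : Tendsto (fun n : ℕ => (k n : ℝ) / (n : ℝ) ^ (3 / 5 : ℝ)) atTop (𝓝 0)) :
    Tendsto (fun n : ℕ => 1 / (k n : ℝ) ^ 2 * (1 + (k n : ℝ) ^ 2 / (n / 6 : ℕ)) ^ 6) atTop
      (𝓝 0) := by
  have h1 : Tendsto (fun n => 1 / (k n : ℝ) ^ 2) atTop (𝓝 0) := by
    simpa only [one_div, Function.comp_def] using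
      tendsto_inv_atTop_zero.comp ((tendsto_pow_atTop two_ne_zero).comp hk)
  -- By convexity `(1 + x) ^ 6 ≤ 2 ^ 5 * (1 + x ^ 6)`, with `x ≤ 12 * k ^ 2 / n` because `n / 6`
  -- rounded down is at least `n / 12`; then `k ^ 10 / n ^ 6` is the tenth power of `k / n ^ (3/5)`.
  have h := (h1.const_mul 32).add ((hk'.pow 10).const_mul (32 * 12 ^ 6))
  norm_num only [mul_zero, add_zero, zero_pow, ne_eq] at h
  refine squeeze_zero' (Eventually.of_forall fun n => by positivity) ?_ h
  filter_upwards [eventually_ge_atTop 12, hk.eventually_gt_atTop 0] with n hn hkn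
  have hn' : (0 : ℝ) < n := by
    have : 0 < n := by omega
    exact_mod_cast this
  have hm : (n : ℝ) / 12 ≤ (n / 6 : ℕ) := by
    rw [div_le_iff₀ (by norm_num)]
    have : n ≤ n / 6 * 12 := by omega
    exact_mod_cast this
  have hpow : (n : ℝ) ^ 6 = ((n : ℝ) ^ (3 / 5 : ℝ)) ^ 10 := by
    rw [← Real.rpow_natCast _ 10, ← Real.rpow_mul hn'.le, ← Real.rpow_natCast]
    norm_num
  have hle : (k n : ℝ) ^ 2 / (n / 6 : ℕ) ≤ (k n : ℝ) ^ 2 / (n / 12) :=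
    div_le_div_of_nonneg_left (by positivity) (by positivity) hm
  calc 1 / (k n : ℝ) ^ 2 * (1 + (k n : ℝ) ^ 2 / (n / 6 : ℕ)) ^ 6
      ≤ 1 / (k n : ℝ) ^ 2 * (1 + (k n : ℝ) ^ 2 / (n / 12)) ^ 6 := by gcongr
    _ ≤ 1 / (k n : ℝ) ^ 2 * (2 ^ 5 * (1 ^ 6 + ((k n : ℝ) ^ 2 / (n / 12)) ^ 6)) := by
        gcongr
        exact add_pow_le zero_le_one (by positivity) 6
    _ = 32 * (1 / (k n : ℝ) ^ 2) + 32 * 12 ^ 6 * ((k n : ℝ) ^ 10 / (n : ℝ) ^ 6) := by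
        field_simp
        ring
    _ = _ := by
        rw [hpow, ← div_pow]
        norm_num

theorem mainTheorem6 (r : ℕ → ℝ) (hr : ∀ n, 0 ≤ r n)
    (hω : (fun n : ℕ => 1 / (n : ℝ) ^ (6 / 5 : ℝ)) =o[atTop] fun n : ℕ => r n ^ 2) :
    Tendsto (fun n : ℕ => rgProb n (r n) fun G => LocalPooling G) atTop (𝓝 0) := by
  have hk := tendsto_gridSize_atTop r
  have hlim := ENNReal.tendsto_ofReal
    (tendsto_occupancy_bound hk (tendsto_gridSize_div_rpow hr hω))
  rw [ENNReal.ofReal_zero] at hlim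
  refine tendsto_of_tendsto_of_tendsto_of_le_of_le' tendsto_const_nhds hlim
    (Eventually.of_forall fun _ => zero_le) ?_
  filter_upwards [eventually_pos_of_isLittleO hr hω, hk.eventually_gt_atTop 0,
    eventually_ge_atTop 6] with n hrn hkn hn
  refine rgProb_localPooling_le ?_ (by exact_mod_cast hkn) (by omega) (by omega)
  rw [← div_le_iff₀ hrn]
  refine (Nat.le_ceil _).trans ?_
  exact_mod_cast Nat.le_add_right _ _
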